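/- Let $m>1$ be an odd integer and let $$H_m=\langle x,y\mid \underbrace{xyxy\cdots yx}_{\text{length }m}=\underbrace{yxyx\cdots xy}_{\text{length }m}\rangle .$$ This group is isomorphic to $\langle A,B\mid A^m=B^2\rangle$ (the standard presentation of the group of the torus knot of type $(m,2)$). For a group $G$ and $g\in G$ let $\tau_g$ be the function $\rho\mapsto \operatorname{tr}\rho(g)$ on the set of all representations $\rho:G\to SL(2,\mathbb C)$, and let $T$ be the ring generated by all the functions $\tau_g$, $g\in G$. If $\gamma_1,\dots,\gamma_\nu\in G$ are such that $\tau_{\gamma_1},\dots,\tau_{\gamma_\nu}$ generate the ring $T$, then the character variety of $G$ is $$X(G)=\{(\tau_{\gamma_1}(\rho),\dots,\tau_{\gamma_\nu}(\rho))\mid \rho:G\to SL(2,\mathbb C)\text{ a representation}\}\subseteq\mathbb C^\nu .$$ Let $q_1,q_2,q_3,\dots\in\mathbb C[T]$ be the polynomials defined recursively by $q_1(T)=T-2$, $q_2(T)=T+2$ and, for $n\ge 3$, $$\prod_{1\ne d\mid n}q_d\!\left(X+\tfrac1X\right)=\frac{X^{n-1}+X^{n-2}+\dots+X+1}{X^{(n-1)/2}}\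 (n\text{ odd}),\qquad \prod_{1,2\ne d\mid n}q_d\!\left(X+\tfrac1X\right)=\frac{X^{n-2}+X^{n-4}+\dots+X^2+1}{X^{(n-2)/2}}\ (n\text{ even}).$$ For a polynomial $g(T)=\sum_{i=0}^n a_iT^i$ of degree $n$ put $g^*(T)=\sum_{i=0}^n(-1)^{n-i}a_iT^i$. Then, for every choice of $\gamma_1,\dots,\gamma_\nu\in H_m$ whose $\tau_{\gamma_i}$ generate $T$, $$X(H_m)\cong\Big\{(X,Z)\in\mathbb C^2\ \Big|\ (X^2-Z-2)\prod_{1\ne d\mid m}q_d^*(Z)=0\Big\},$$ where $\cong$ means that there are polynomial maps in both directions which restrict to mutually inverse bijections between the two sets. Moreover $\tau_x,\tau_y,\tau_{xy}$ generate $T$, and the character variety defined by $(\tau_x,\tau_y,\tau_{xy})$ is the set of all $(X,Y,Z)\in\mathbb C^3$ such that $Y=X$ and $(X,Z)$ lies in the set on the right-hand side. -/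

import Mathlib

open Polynomial

/-! ## The SL(2,ℂ) character variety of a group -/

/-- `τ_g`, as a function on the set of all representations `ρ : G → SL(2,ℂ)`:
`τ_g(ρ) = tr ρ(g)`. -/
noncomputable def traceFun {G : Type*} [Group G] (g : G) :
    (G →* Matrix.SpecialLinearGroup (Fin 2) ℂ) → ℂ :=
  fun ρ => (ρ g : Matrix (Fin 2) (Fin 2) ℂ).trace

/-- The ring `T` generated by all the functions `τ_g`, `g ∈ G`. -/
noncomputable def traceRing (G : Type*) [Group G] :
    Subring ((G →* Matrix.SpecialLinearGroup (Fin 2) ℂ) → ℂ) :=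
  Subring.closure (Set.range (traceFun (G := G)))

/-- The family `γ` of elements of `G` is such that the `τ_{γ i}` generate the ring `T`. -/
def GeneratesTraceRing {G : Type*} [Group G] {ι : Type*} (γ : ι → G) : Prop :=
  Subring.closure (Set.range fun i => traceFun (γ i)) = traceRing G

/-- The image of the map `t(ρ) = (τ_{γ i}(ρ))_i`. When `γ` is a finite family such that the
`τ_{γ i}` generate the ring `T`, this is the character variety `X(G)`
(well defined up to isomorphism, as it depends on the choice of `γ`). -/
def characterVariety {G : Type*} [Group G] {ι : Type*} (γ : ι → G) : Set (ι → ℂ) :=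
  Set.range fun (ρ : G →* Matrix.SpecialLinearGroup (Fin 2) ℂ) (i : ι) => traceFun (γ i) ρ

/-- The polynomial map `ℂ^ι → ℂ^κ` with components `F k`. -/
noncomputable def polyMap {ι κ : Type*} (F : κ → MvPolynomial ι ℂ) (v : ι → ℂ) : κ → ℂ :=
  fun k => MvPolynomial.eval v (F k)

/-- `V ≅ W` as subsets of affine spaces: there are polynomial maps which restrict to mutually
inverse bijections between `V` and `W`. -/
def AlgSetIso {ι κ : Type*} (V : Set (ι → ℂ)) (W : Set (κ → ℂ)) : Prop :=
  ∃ (F : κ → MvPolynomial ι ℂ) (E : ι → MvPolynomial κ ℂ),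
    (∀ v ∈ V, polyMap F v ∈ W) ∧ (∀ w ∈ W, polyMap E w ∈ V) ∧
    (∀ v ∈ V, polyMap E (polyMap F v) = v) ∧ (∀ w ∈ W, polyMap F (polyMap E w) = w)

/-! ## The groups -/

/-- The alternating word `abab…` of length `n`. -/
def altWord {M : Type*} [Monoid M] (a b : M) : ℕ → M
  | 0 => 1
  | n + 1 => a * altWord b a n

/-- `H_m = ⟨x, y | xyxy… = yxyx…⟩`, both words of length `m`. -/
abbrev GroupH (m : ℕ) : Type :=
  PresentedGroup ({altWord (FreeGroup.of 0) (FreeGroup.of 1) m *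
    (altWord (FreeGroup.of 1) (FreeGroup.of 0) m)⁻¹} : Set (FreeGroup (Fin 2)))

/-- The generator `x` of `H_m`. -/
def GroupH.x (m : ℕ) : GroupH m := PresentedGroup.of 0

/-- The generator `y` of `H_m`. -/
def GroupH.y (m : ℕ) : GroupH m := PresentedGroup.of 1

/-- `⟨A, B | A^m = B^n⟩`, the standard presentation of the group of the torus knot of
type `(m, n)`. -/
abbrev TorusKnotGroup (m n : ℕ) : Type :=
  PresentedGroup ({FreeGroup.of 0 ^ m * (FreeGroup.of 1 ^ n)⁻¹} : Set (FreeGroup (Fin 2)))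

/-! ## The polynomials `q_d` and the involution `*` -/

/-- The equations that define the polynomials `q_n`, `n ≥ 1`, recursively (the unused value `q_0`
is set to `0`). -/
structure IsQFamily (q : ℕ → ℂ[X]) : Prop where
  zero : q 0 = 0
  one : q 1 = X - C 2
  two : q 2 = X + C 2
  odd : ∀ n : ℕ, 3 ≤ n → Odd n → ∀ x : ℂ, x ≠ 0 →
    ∏ d ∈ n.divisors \ {1}, (q d).eval (x + 1 / x) =
      (∑ i ∈ Finset.range n, x ^ i) / x ^ ((n - 1) / 2)
  even : ∀ n : ℕ, 3 ≤ n → Even n → ∀ x : ℂ, x ≠ 0 →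
    ∏ d ∈ n.divisors \ {1, 2}, (q d).eval (x + 1 / x) =
      (∑ i ∈ Finset.range (n / 2), x ^ (2 * i)) / x ^ ((n - 2) / 2)

theorem exists_add_inv_eq (z : ℂ) : ∃ x : ℂ, x ≠ 0 ∧ x + 1 / x = z := by
  obtain ⟨s, hs⟩ := IsAlgClosed.exists_pow_nat_eq (z ^ 2 - 4) (n := 2) (by norm_num)
  have h0 : (z + s) / 2 ≠ 0 := by
    intro h
    have h1 : s = -z := by linear_combination 2 * h
    rw [h1] at hs
    have : (4 : ℂ) = 0 := by linear_combination hs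
    norm_num at this
  refine ⟨(z + s) / 2, h0, ?_⟩
  have h3 : z + s ≠ 0 := fun h => h0 (by rw [h]; simp)
  field_simp
  linear_combination hs

theorem isQFamily_unique {q r : ℕ → ℂ[X]} (hq : IsQFamily q) (hr : IsQFamily r) : q = r := by
  have hcard : ∀ p : ℂ[X], p ≠ 0 → {z | p.eval z = 0}.Finite := fun p hp =>
    (p.roots.toFinset.finite_toSet).subset fun z hz => by simpa [hp] using hz
  -- an identity of products determines the last factor
  have key : ∀ (n : ℕ) (s : Finset ℕ) (f : ℂ → ℂ), n ∈ s →
      (∀ d ∈ s, d ≠ n → q d = r d) →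
      (∀ x : ℂ, x ≠ 0 → ∏ d ∈ s, (q d).eval (x + 1 / x) = f x) →
      (∀ x : ℂ, x ≠ 0 → ∏ d ∈ s, (r d).eval (x + 1 / x) = f x) →
      (∃ x : ℂ, x ≠ 0 ∧ f x ≠ 0) → q n = r n := by
    intro n s f hn hd h1 h2 ⟨x0, hx0, hf⟩
    have e : ∏ d ∈ s, q d = ∏ d ∈ s, r d := by
      apply Polynomial.funext
      intro z
      obtain ⟨x, hx, rfl⟩ := exists_add_inv_eq z
      rw [eval_prod, eval_prod, h1 x hx, h2 x hx]
    rw [← Finset.mul_prod_erase s q hn, ← Finset.mul_prod_erase s r hn] at e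
    have e2 : ∏ d ∈ s.erase n, q d = ∏ d ∈ s.erase n, r d :=
      Finset.prod_congr rfl fun d hd' =>
        hd d (Finset.mem_of_mem_erase hd') (Finset.ne_of_mem_erase hd')
    rw [e2] at e
    refine mul_right_cancel₀ ?_ e
    intro h0
    apply hf
    rw [← h2 x0 hx0, ← eval_prod, ← Finset.mul_prod_erase s r hn, h0]
    simp
  funext n
  induction n using Nat.strong_induction_on with
  | _ n ih =>
    rcases Nat.lt_or_ge n 3 with h3 | h3
    · interval_cases n
      · rw [hq.zero, hr.zero]
      · rw [hq.one, hr.one]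
      · rw [hq.two, hr.two]
    have hlt : ∀ d ∈ n.divisors, d ≠ n → q d = r d := fun d hd hne =>
      ih d (lt_of_le_of_ne (Nat.divisor_le hd) hne)
    rcases Nat.even_or_odd n with h | h
    · refine key n (n.divisors \ {1, 2}) _ ?_ (fun d hd => hlt d (Finset.mem_sdiff.1 hd).1)
        (hq.even n h3 h) (hr.even n h3 h) ⟨1, one_ne_zero, ?_⟩
      · simp; omega
      · simp; omega
    · refine key n (n.divisors \ {1}) _ ?_ (fun d hd => hlt d (Finset.mem_sdiff.1 hd).1)
        (hq.odd n h3 h) (hr.odd n h3 h) ⟨1, one_ne_zero, ?_⟩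
      · simp; omega
      · simp; omega

/-- For `n ≥ 3` the `n`-th cyclotomic polynomial is `X^c q(X + 1/X)`, `2c` being its degree. -/
theorem exists_cyclotomic_eq (n : ℕ) (hn : 3 ≤ n) : ∃ (q : ℂ[X]) (c : ℕ), 2 * c = n.totient ∧
    ∀ x : ℂ, x ≠ 0 → (cyclotomic n ℂ).eval x = x ^ c * q.eval (x + 1 / x) := by
  have hn0 : n ≠ 0 := by omega
  have : NeZero n := ⟨hn0⟩
  obtain ⟨ζ, hζ⟩ : ∃ ζ : ℂ, IsPrimitiveRoot ζ n := ⟨_, Complex.isPrimitiveRoot_exp n hn0⟩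
  have hζ0 : ζ ≠ 0 := hζ.ne_zero hn0
  set A := (Finset.range n).filter fun k => n.Coprime k with hA
  set L := A.filter fun k => 2 * k < n with hL
  have hprod : ∀ x : ℂ, (cyclotomic n ℂ).eval x = ∏ k ∈ A, (x - ζ ^ k) := by
    intro x
    rw [cyclotomic_eq_prod_X_sub_primitiveRoots hζ, eval_prod]
    simp only [eval_sub, eval_X, eval_C]
    symm
    refine Finset.prod_bij (fun k _ => ζ ^ k) ?_ ?_ ?_ ?_
    · intro k hk
      simp only [hA, Finset.mem_filter, Finset.mem_range] at hk
      rw [mem_primitiveRoots (by omega)]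
      exact hζ.pow_of_coprime k hk.2.symm
    · intro a ha b hb hab
      simp only [hA, Finset.mem_filter, Finset.mem_range] at ha hb
      exact hζ.pow_inj ha.1 hb.1 hab
    · intro ξ hξ
      rw [mem_primitiveRoots (by omega)] at hξ
      obtain ⟨i, hi, hco, rfl⟩ := hζ.isPrimitiveRoot_iff.1 hξ
      exact ⟨i, Finset.mem_filter.2 ⟨Finset.mem_range.2 hi, hco.symm⟩, rfl⟩
    · intros; rfl
  have hmem : ∀ k, k ∈ L ↔ n.Coprime k ∧ 2 * k < n := by
    intro k
    simp only [hL, hA, Finset.mem_filter, Finset.mem_range]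
    constructor
    · rintro ⟨⟨_, h⟩, h'⟩; exact ⟨h, h'⟩
    · rintro ⟨h, h'⟩; exact ⟨⟨by omega, h⟩, h'⟩
  have hpos : ∀ k, n.Coprime k → 0 < k := by
    intro k hk
    rcases Nat.eq_zero_or_pos k with rfl | h
    · simp at hk; omega
    · exact h
  have hhalf : ∀ k, n.Coprime k → 2 * k ≠ n := by
    intro k hk h
    have : k ∣ n.gcd k := Nat.dvd_gcd ⟨2, by omega⟩ dvd_rfl
    rw [hk] at this
    have := Nat.dvd_one.1 this
    omega
  -- the other half is the image of `L` under `k ↦ n - k`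
  have hsplit : ∀ {M : Type} [CommMonoid M] (f : ℕ → M),
      ∏ k ∈ A, f k = ∏ k ∈ L, f k * f (n - k) := by
    intro M _ f
    rw [← Finset.prod_filter_mul_prod_filter_not A (fun k => 2 * k < n), Finset.prod_mul_distrib]
    congr 1
    symm
    refine Finset.prod_bij (fun k _ => n - k) ?_ ?_ ?_ ?_
    · intro k hk
      have hk' := (hmem k).1 hk
      have := hpos k hk'.1
      simp only [hA, Finset.mem_filter, Finset.mem_range]
      refine ⟨⟨by omega, ?_⟩, by omega⟩
      exact (Nat.coprime_self_sub_right (by omega)).2 hk'.1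
    · intro a ha b hb hab
      have ha' := (hmem a).1 ha
      have hb' := (hmem b).1 hb
      omega
    · intro b hb
      simp only [hA, Finset.mem_filter, Finset.mem_range] at hb
      have := hhalf b hb.1.2
      refine ⟨n - b, (hmem _).2 ⟨(Nat.coprime_self_sub_right (by omega)).2 hb.1.2, by omega⟩, ?_⟩
      omega
    · intros; rfl
  refine ⟨∏ k ∈ L, (X - C (ζ ^ k + ζ ^ (n - k))), L.card, ?_, ?_⟩
  · have hc : A.card = n.totient := rfl
    have h := hsplit (fun _ => Multiplicative.ofAdd (1 : ℕ))
    simp only [Finset.prod_const, ← ofAdd_add, ← ofAdd_nsmul] at h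
    have h' := Multiplicative.ofAdd.injective h
    simp only [smul_eq_mul] at h'
    omega
  · intro x hx
    rw [hprod, hsplit, eval_prod, ← Finset.prod_const, ← Finset.prod_mul_distrib]
    refine Finset.prod_congr rfl fun k hk => ?_
    have hk' := (hmem k).1 hk
    have e : ζ ^ k * ζ ^ (n - k) = 1 := by
      rw [← pow_add, Nat.add_sub_cancel' (by omega), hζ.pow_eq_one]
    simp only [eval_sub, eval_X, eval_C]
    field_simp
    linear_combination e

theorem exists_isQFamily : ∃ q : ℕ → ℂ[X], IsQFamily q := by
  choose! q c hc hq using exists_cyclotomic_eq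
  let q' : ℕ → ℂ[X] := fun n =>
    if n = 0 then 0 else if n = 1 then X - C 2 else if n = 2 then X + C 2 else q n
  have hq' : ∀ n, 3 ≤ n → q' n = q n := fun n hn => by
    simp only [q']; rw [if_neg, if_neg, if_neg] <;> omega
  have hprod : ∀ (s : Finset ℕ), (∀ d ∈ s, 3 ≤ d) → ∀ x : ℂ, x ≠ 0 →
      ∏ d ∈ s, (q' d).eval (x + 1 / x) =
        (∏ d ∈ s, cyclotomic d ℂ).eval x / x ^ (∑ d ∈ s, d.totient / 2) := by
    intro s hs x hx
    rw [eval_prod, ← Finset.prod_pow_eq_pow_sum, ← Finset.prod_div_distrib]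
    refine Finset.prod_congr rfl fun d hd => ?_
    have hd3 := hs d hd
    rw [hq' d hd3, hq d hd3 x hx, ← hc d hd3, Nat.mul_div_cancel_left _ (by norm_num)]
    field_simp
  have hsum : ∀ (s : Finset ℕ), (∀ d ∈ s, 3 ≤ d) →
      2 * ∑ d ∈ s, d.totient / 2 = ∑ d ∈ s, d.totient := by
    intro s hs
    rw [Finset.mul_sum]
    refine Finset.sum_congr rfl fun d hd => ?_
    have := hc d (hs d hd)
    omega
  refine ⟨q', by simp [q'], by simp [q'], by simp [q'], ?_, ?_⟩
  · intro n hn hodd x hx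
    have hs : ∀ d ∈ n.divisors \ {1}, 3 ≤ d := by
      intro d hd
      simp only [Finset.mem_sdiff, Nat.mem_divisors, Finset.mem_singleton] at hd
      have h1 := Odd.of_dvd_nat hodd hd.1.1
      obtain ⟨k, hk⟩ := h1
      omega
    have h1 : ({1} : Finset ℕ) ⊆ n.divisors := by simp; omega
    rw [hprod _ hs x hx]
    congr 2
    · rw [Finset.sdiff_singleton_eq_erase, prod_cyclotomic_eq_geom_sum (by omega), eval_finsetSum]
      simp
    · have h2 := hsum _ hs
      have h3 := Finset.sum_sdiff (f := Nat.totient) h1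
      rw [Nat.sum_totient] at h3
      simp only [Finset.sum_singleton, Nat.totient_one] at h3
      omega
  · intro n hn heven x hx
    obtain ⟨k, hk⟩ := heven
    have hs : ∀ d ∈ n.divisors \ {1, 2}, 3 ≤ d := by
      intro d hd
      simp only [Finset.mem_sdiff, Nat.mem_divisors, Finset.mem_insert, Finset.mem_singleton] at hd
      have : d ≠ 0 := by rintro rfl; simp at hd
      omega
    have h1 : ({1, 2} : Finset ℕ) ⊆ n.divisors := by
      intro d hd
      simp only [Finset.mem_insert, Finset.mem_singleton] at hd
      rw [Nat.mem_divisors]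
      refine ⟨?_, by omega⟩
      rcases hd with rfl | rfl
      · simp
      · exact ⟨k, by omega⟩
    rw [hprod _ hs x hx]
    have h12 : (1 : ℕ) ≠ 2 := by norm_num
    congr 2
    · have e : ∏ d ∈ n.divisors \ {1, 2}, cyclotomic d ℂ
          = ∑ i ∈ Finset.range (n / 2), (X ^ 2 : ℂ[X]) ^ i := by
        have hne : (X ^ 2 - 1 : ℂ[X]) ≠ 0 := (monic_X_pow_sub_C (1 : ℂ) two_ne_zero).ne_zero
        refine mul_right_cancel₀ hne ?_
        rw [geom_sum_mul, ← pow_mul, show 2 * (n / 2) = n by omega,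
          ← prod_cyclotomic_eq_X_pow_sub_one (by omega : 0 < n), ← Finset.prod_sdiff h1,
          Finset.prod_pair h12, cyclotomic_one, cyclotomic_two]
        ring
      rw [e, eval_finsetSum]
      simp [pow_mul]
    · have h2 := hsum _ hs
      have h3 := Finset.sum_sdiff (f := Nat.totient) h1
      rw [Nat.sum_totient, Finset.sum_pair h12, Nat.totient_one, Nat.totient_two] at h3
      omega

/-- The polynomials `q_n`: the unique family that satisfies the defining equations. -/
noncomputable def qPoly : ℕ → ℂ[X] := exists_isQFamily.choose

theorem qPoly_spec : IsQFamily qPoly := exists_isQFamily.choose_spec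

/-- The involution `g = ∑ a_i T^i ↦ g^* = ∑ (-1)^(n-i) a_i T^i`, where `n = deg g`. -/
noncomputable def starPoly {R : Type*} [Ring R] (g : R[X]) : R[X] :=
  ∑ i ∈ Finset.range (g.natDegree + 1), C ((-1) ^ (g.natDegree - i) * g.coeff i) * X ^ i

/-- The set of all `(X, Z) ∈ ℂ²` with `(X² - Z - 2) ∏_{1 ≠ d ∣ m} q_d^*(Z) = 0`;
the coordinates are `X = v 0` and `Z = v 1`. -/
def curveH (m : ℕ) : Set (Fin 2 → ℂ) :=
  {v | (v 0 ^ 2 - v 1 - 2) * ∏ d ∈ m.divisors \ {1}, (starPoly (qPoly d)).eval (v 1) = 0}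

/-! Write `m = 2k + 1`. The relation says `(xy)^k x = y (xy)^k`, so `x` and `y` are conjugate and
`τ_x = τ_y` on every representation. This is the equation `Y = X`.

For `A`, `B` in `SL(2,ℂ)` of equal trace, Cayley–Hamilton for `AB` gives a second-order linear
recurrence in `k` for `(AB)^k A - (BA)^k B`. Its solution is a scalar times `A - B`
(`smul_pow_mul_sub_pow_mul`). With `t + 1/t = -tr(AB)` the scalar is, up to a unit, `1 + t + … +
t^(m-1)`, hence up to sign a power of `t` times the product of the `q_d^*` at `tr(AB)`. So the
relation holds exactly when `A = B`, which gives `Z = X² - 2`, or when that product vanishes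
(`altWord_eq_iff`). Explicit matrices realize every point of the curve
(`GroupH.characterVariety_eq`).

The functions `τ_x`, `τ_y`, `τ_{xy}` generate the trace ring because products of the matrices reduce
to combinations of `1`, `ρ x`, `ρ y`, `ρ (xy)` (`generatesTraceRing_pair`). Two generating families
are polynomials in each other, so any family gives an isomorphic set
(`GeneratesTraceRing.algSetIso`). -/

/-! ### Trace identities in `SL(2,ℂ)` -/

/-- The Cayley–Hamilton theorem for `2 × 2` matrices of determinant `1`. -/
theorem SpecialLinearGroup.mul_self_eq (A : Matrix.SpecialLinearGroup (Fin 2) ℂ) :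
    (A * A : Matrix (Fin 2) (Fin 2) ℂ) = (A : Matrix (Fin 2) (Fin 2) ℂ).trace • A.1 - 1 := by
  have hA := A.det_coe
  rw [Matrix.det_fin_two] at hA
  ext i j
  fin_cases i <;> fin_cases j <;>
    simp [Matrix.mul_apply, Fin.sum_univ_two, Matrix.trace_fin_two] <;> grind

theorem SpecialLinearGroup.inv_eq (A : Matrix.SpecialLinearGroup (Fin 2) ℂ) :
    ((A⁻¹ : Matrix.SpecialLinearGroup (Fin 2) ℂ) : Matrix (Fin 2) (Fin 2) ℂ) =
      (A : Matrix (Fin 2) (Fin 2) ℂ).trace • 1 - A.1 := by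
  rw [Matrix.SpecialLinearGroup.coe_inv, Matrix.adjugate_fin_two]
  ext i j
  fin_cases i <;> fin_cases j <;> simp [Matrix.trace_fin_two]

/-- The polarized Cayley–Hamilton theorem for `2 × 2` matrices. -/
theorem mul_add_mul_comm_fin_two {R : Type*} [CommRing R] (A B : Matrix (Fin 2) (Fin 2) R) :
    B * A = -(A * B) + A.trace • B + B.trace • A + ((A * B).trace - A.trace * B.trace) • 1 := by
  ext i j
  fin_cases i <;> fin_cases j <;>
    simp [Matrix.mul_apply, Fin.sum_univ_two, Matrix.trace_fin_two] <;> ring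

/-- Since `ABA = (AB)² B⁻¹`, Cayley–Hamilton for `AB` and the formula for `B⁻¹` suffice. -/
theorem SpecialLinearGroup.mul_mul_self_eq (A B : Matrix.SpecialLinearGroup (Fin 2) ℂ) :
    A.1 * B.1 * A.1 = (A.1 * B.1).trace • A.1 + B.1 - B.1.trace • 1 := by
  have h := SpecialLinearGroup.mul_self_eq (A * B)
  have h2 : A.1 * B.1 * A.1 =
      (A * B * (A * B)).1 * (B⁻¹ : Matrix.SpecialLinearGroup (Fin 2) ℂ).1 := by
    simp only [← Matrix.SpecialLinearGroup.coe_mul]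
    exact congrArg Subtype.val (by group : A * B * A = A * B * (A * B) * B⁻¹)
  have h3 : (A * B).1 * (B⁻¹ : Matrix.SpecialLinearGroup (Fin 2) ℂ).1 = A.1 := by
    rw [← Matrix.SpecialLinearGroup.coe_mul, mul_inv_cancel_right]
  rw [h2, Matrix.SpecialLinearGroup.coe_mul, h, sub_mul, smul_mul_assoc, h3,
    SpecialLinearGroup.inv_eq B, one_mul, Matrix.SpecialLinearGroup.coe_mul]
  abel

/-! ### The relation of `H_m` for matrices of equal trace -/

theorem altWord_add_two {M : Type*} [Monoid M] (a b : M) (n : ℕ) :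
    altWord a b (n + 2) = a * b * altWord a b n := by
  simp [altWord, mul_assoc]

theorem altWord_odd {M : Type*} [Monoid M] (a b : M) (k : ℕ) :
    altWord a b (2 * k + 1) = (a * b) ^ k * a := by
  induction k with
  | zero => simp [altWord]
  | succ k ih =>
    rw [show 2 * (k + 1) + 1 = 2 * k + 1 + 2 by ring, altWord_add_two, ih, pow_succ', mul_assoc,
      mul_assoc, mul_assoc]

theorem map_altWord {M N F : Type*} [Monoid M] [Monoid N] [FunLike F M N] [MonoidHomClass F M N]
    (f : F) (a b : M) (n : ℕ) :
    f (altWord a b n) = altWord (f a) (f b) n := by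
  induction n generalizing a b with
  | zero => simp [altWord]
  | succ n ih => simp [altWord, ih]

/-- For matrices of equal trace the two sides of the relation of `H_{2k+1}` differ by a multiple
of `A - B`, which is determined by the trace of `A * B`. -/
theorem smul_pow_mul_sub_pow_mul (A B : Matrix.SpecialLinearGroup (Fin 2) ℂ)
    (hAB : A.1.trace = B.1.trace) {t : ℂ} (ht : t ≠ 0)
    (hz : t + 1 / t = -(A.1 * B.1).trace) (k : ℕ) :
    t ^ k • ((A.1 * B.1) ^ k * A.1 - (B.1 * A.1) ^ k * B.1) =
      ((-1) ^ k * ∑ i ∈ Finset.range (2 * k + 1), t ^ i) • (A.1 - B.1) := by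
  have hz' : t * (A.1 * B.1).trace = -(t ^ 2 + 1) := by
    field_simp at hz
    linear_combination hz
  have hBA : (B.1 * A.1).trace = (A.1 * B.1).trace := Matrix.trace_mul_comm _ _
  induction k using Nat.twoStepInduction with
  | zero => simp
  | one =>
    have h1 := SpecialLinearGroup.mul_mul_self_eq A B
    have h2 := SpecialLinearGroup.mul_mul_self_eq B A
    rw [hBA] at h2
    have e : A.1 * B.1 * A.1 - B.1 * A.1 * B.1 = ((A.1 * B.1).trace - 1) • (A.1 - B.1) := by
      rw [h1, h2, hAB]; module
    rw [pow_one, pow_one, pow_one, e, smul_smul]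
    congr 1
    simp only [Finset.sum_range_succ, Finset.sum_range_zero]
    linear_combination hz'
  -- Both words satisfy `W (k+2) = z W (k+1) - W k` with the same `z = tr(AB) = tr(BA)`, hence so
  -- does their difference. The factor `t ^ k` clears the denominators of `z = -(t + 1/t)`.
  | more k ih1 ih2 =>
    have step : ∀ C D : Matrix.SpecialLinearGroup (Fin 2) ℂ, (C.1 * D.1) ^ (k + 2) * C.1 =
        (C.1 * D.1).trace • ((C.1 * D.1) ^ (k + 1) * C.1) - (C.1 * D.1) ^ k * C.1 := by
      intro C D
      have h := SpecialLinearGroup.mul_self_eq (C * D)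
      simp only [Matrix.SpecialLinearGroup.coe_mul] at h
      rw [pow_add, pow_two, h, pow_succ, mul_sub, mul_smul_comm, sub_mul, smul_mul_assoc, mul_one]
    have hs : ∀ n, ∑ i ∈ Finset.range (2 * (n + 1) + 1), t ^ i =
        ∑ i ∈ Finset.range (2 * n + 1), t ^ i + t ^ (2 * n + 1) + t ^ (2 * n + 2) := by
      intro n
      rw [show 2 * (n + 1) + 1 = 2 * n + 1 + 1 + 1 by ring, Finset.sum_range_succ,
        Finset.sum_range_succ]
    rw [step A B, step B A, hBA]
    have e : ∀ (z : ℂ) (U V U' V' : Matrix (Fin 2) (Fin 2) ℂ),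
        t ^ (k + 2) • (z • U - U' - (z • V - V')) =
          (t * z) • t ^ (k + 1) • (U - V) - t ^ 2 • t ^ k • (U' - V') := by
      intro z U V U' V'
      simp only [smul_sub, smul_smul]
      ring_nf
      module
    rw [e, ih1, ih2, hz', smul_smul, smul_smul, ← sub_smul]
    congr 1
    rw [hs (k + 1), hs k]
    ring

/-- Up to sign, the involution is `Z ↦ -Z`; this is why `t + 1/t` is set equal to minus the trace.
-/
theorem eval_starPoly (g : ℂ[X]) (z : ℂ) :
    (starPoly g).eval z = (-1) ^ g.natDegree * g.eval (-z) := by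
  rw [starPoly, eval_finsetSum, Polynomial.eval_eq_sum_range, Finset.mul_sum]
  refine Finset.sum_congr rfl fun i hi => ?_
  have hi' : i ≤ g.natDegree := Nat.lt_succ_iff.1 (Finset.mem_range.1 hi)
  obtain ⟨j, hj⟩ := Nat.exists_eq_add_of_le hi'
  have h1 : ((-1 : ℂ) ^ i) * (-1) ^ i = 1 := by rw [← mul_pow]; simp
  simp only [eval_mul, eval_C, eval_pow, eval_X]
  rw [neg_pow z, hj, Nat.add_sub_cancel_left, pow_add]
  linear_combination -(-1) ^ j * g.coeff i * z ^ i * h1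

/-- The signs from `eval_starPoly` and the power of `t` in the defining equation of the `q_d` are
units, so only the geometric sum can vanish. -/
theorem prod_starPoly_eval_eq_zero_iff {n : ℕ} (hn : 3 ≤ n) (hodd : Odd n) {t z : ℂ} (ht : t ≠ 0)
    (hz : t + 1 / t = -z) :
    ∏ d ∈ n.divisors \ {1}, (starPoly (qPoly d)).eval z = 0 ↔
      ∑ i ∈ Finset.range n, t ^ i = 0 := by
  have h := qPoly_spec.odd n hn hodd t ht
  simp only [eval_starPoly, Finset.prod_mul_distrib, ← hz, h]
  simp [ht, Finset.prod_eq_zero_iff]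

/-- Two matrices of equal trace define a representation of `H_m` if and only if they are equal or
the trace of their product is a root of `∏ q_d^*`. -/
theorem altWord_eq_iff {m : ℕ} (hm : 3 ≤ m) (hodd : Odd m)
    (A B : Matrix.SpecialLinearGroup (Fin 2) ℂ) (hAB : A.1.trace = B.1.trace) :
    altWord A B m = altWord B A m ↔
      A = B ∨ ∏ d ∈ m.divisors \ {1}, (starPoly (qPoly d)).eval (A.1 * B.1).trace = 0 := by
  obtain ⟨t, ht, hz⟩ := exists_add_inv_eq (-(A.1 * B.1).trace)
  rw [prod_starPoly_eval_eq_zero_iff hm hodd ht hz]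
  obtain ⟨k, rfl⟩ := hodd
  have h := smul_pow_mul_sub_pow_mul A B hAB ht hz k
  rw [altWord_odd, altWord_odd]
  have e : ∀ C D : Matrix.SpecialLinearGroup (Fin 2) ℂ, C = D ↔ C.1 - D.1 = 0 := fun C D => by
    rw [sub_eq_zero]; exact Subtype.ext_iff
  rw [e ((A * B) ^ k * A), e A, Matrix.SpecialLinearGroup.coe_mul, Matrix.SpecialLinearGroup.coe_mul,
    Matrix.SpecialLinearGroup.coe_pow, Matrix.SpecialLinearGroup.coe_pow,
    Matrix.SpecialLinearGroup.coe_mul, Matrix.SpecialLinearGroup.coe_mul,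
    ← smul_eq_zero_iff_right (pow_ne_zero k ht), h, smul_eq_zero, or_comm]
  simp

/-! ### Presentations and the torus knot group -/

theorem GroupH.altWord_eq (m : ℕ) :
    altWord (GroupH.x m) (GroupH.y m) m = altWord (GroupH.y m) (GroupH.x m) m := by
  have h := PresentedGroup.one_of_mem (rels := ({altWord (FreeGroup.of 0) (FreeGroup.of 1) m *
    (altWord (FreeGroup.of 1) (FreeGroup.of 0) m)⁻¹} : Set (FreeGroup (Fin 2))))
    (Set.mem_singleton _)
  rw [map_mul, map_inv, mul_inv_eq_one, map_altWord, map_altWord] at h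
  exact h

/-- The homomorphism from `H_m` determined by the images of `x` and `y`. -/
noncomputable def GroupH.lift {G : Type*} [Group G] {m : ℕ} (a b : G)
    (h : altWord a b m = altWord b a m) : GroupH m →* G :=
  PresentedGroup.toGroup (f := ![a, b]) <| by
    rintro _ rfl
    rw [map_mul, map_inv, mul_inv_eq_one, map_altWord, map_altWord]
    simpa using h

@[simp]
theorem GroupH.lift_x {G : Type*} [Group G] {m : ℕ} (a b : G)
    (h : altWord a b m = altWord b a m) : GroupH.lift a b h (GroupH.x m) = a :=
  PresentedGroup.toGroup.of _

@[simp]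
theorem GroupH.lift_y {G : Type*} [Group G] {m : ℕ} (a b : G)
    (h : altWord a b m = altWord b a m) : GroupH.lift a b h (GroupH.y m) = b :=
  PresentedGroup.toGroup.of _

theorem GroupH.hom_ext {G : Type*} [Group G] {m : ℕ} {f g : GroupH m →* G}
    (hx : f (GroupH.x m) = g (GroupH.x m)) (hy : f (GroupH.y m) = g (GroupH.y m)) : f = g := by
  refine PresentedGroup.ext fun i => ?_
  fin_cases i
  · exact hx
  · exact hy

theorem TorusKnotGroup.pow_eq (m n : ℕ) :
    (PresentedGroup.of 0 : TorusKnotGroup m n) ^ m =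
      (PresentedGroup.of 1 : TorusKnotGroup m n) ^ n := by
  have h := PresentedGroup.one_of_mem
    (rels := ({FreeGroup.of 0 ^ m * (FreeGroup.of 1 ^ n)⁻¹} : Set (FreeGroup (Fin 2))))
    (Set.mem_singleton _)
  rw [map_mul, map_inv, mul_inv_eq_one, map_pow, map_pow] at h
  exact h

/-- The homomorphism from `⟨A, B | A^m = B^n⟩` determined by the images of `A` and `B`. -/
noncomputable def TorusKnotGroup.lift {G : Type*} [Group G] {m n : ℕ} (a b : G)
    (h : a ^ m = b ^ n) : TorusKnotGroup m n →* G :=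
  PresentedGroup.toGroup (f := ![a, b]) <| by
    rintro _ rfl
    rw [map_mul, map_inv, mul_inv_eq_one, map_pow, map_pow]
    simpa using h

@[simp]
theorem TorusKnotGroup.lift_zero {G : Type*} [Group G] {m n : ℕ} (a b : G)
    (h : a ^ m = b ^ n) : TorusKnotGroup.lift a b h (PresentedGroup.of 0) = a :=
  PresentedGroup.toGroup.of _

@[simp]
theorem TorusKnotGroup.lift_one {G : Type*} [Group G] {m n : ℕ} (a b : G)
    (h : a ^ m = b ^ n) : TorusKnotGroup.lift a b h (PresentedGroup.of 1) = b :=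
  PresentedGroup.toGroup.of _

theorem inv_pow_mul_mul_inv_mul_pow_succ {G : Type*} [Group G] (a b : G) (k : ℕ) :
    (a ^ k)⁻¹ * b * (b⁻¹ * a ^ (k + 1)) = a := by
  rw [pow_succ]
  group

/-- With `x = a⁻ᵏ b` and `y = b⁻¹ aᵏ⁺¹` one has `xy = a`, so `(xy)^k x = b`, while `y (xy)^k = b⁻¹
a²ᵏ⁺¹ = b`. -/
theorem altWord_eq_of_pow_eq_sq {G : Type*} [Group G] (a b : G) {k : ℕ}
    (h : a ^ (2 * k + 1) = b ^ 2) :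
    altWord ((a ^ k)⁻¹ * b) (b⁻¹ * a ^ (k + 1)) (2 * k + 1) =
      altWord (b⁻¹ * a ^ (k + 1)) ((a ^ k)⁻¹ * b) (2 * k + 1) := by
  rw [altWord_odd, altWord_odd, mul_pow_mul (b⁻¹ * a ^ (k + 1)),
    inv_pow_mul_mul_inv_mul_pow_succ, mul_inv_cancel_left, mul_assoc, ← pow_add,
    show k + 1 + k = 2 * k + 1 by ring, h, pow_two, inv_mul_cancel_left]

/-- Replace the second factor of the square by `y (xy)^k`, to which it is equal by the relation. -/
theorem pow_eq_sq_of_altWord_eq {G : Type*} [Group G] (x y : G) {k : ℕ}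
    (h : altWord x y (2 * k + 1) = altWord y x (2 * k + 1)) :
    (x * y) ^ (2 * k + 1) = ((x * y) ^ k * x) ^ 2 := by
  rw [altWord_odd, altWord_odd, mul_pow_mul y x] at h
  rw [pow_two]
  nth_rw 2 [h]
  rw [show 2 * k + 1 = k + 1 + k by ring, pow_add, pow_succ]
  simp only [mul_assoc]

/-- The substitutions `x = A⁻ᵏ B`, `y = B⁻¹ Aᵏ⁺¹` and `A = xy`, `B = (xy)^k x` undo each other. -/
theorem nonempty_groupH_mulEquiv_torusKnotGroup {m : ℕ} (hodd : Odd m) :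
    Nonempty (GroupH m ≃* TorusKnotGroup m 2) := by
  obtain ⟨k, rfl⟩ := hodd
  refine ⟨MonoidHom.toMulEquiv
    (GroupH.lift _ _ (altWord_eq_of_pow_eq_sq _ _ (TorusKnotGroup.pow_eq (2 * k + 1) 2)))
    (TorusKnotGroup.lift _ _ (pow_eq_sq_of_altWord_eq _ _ (GroupH.altWord_eq (2 * k + 1)))) ?_ ?_⟩
  · refine GroupH.hom_ext ?_ ?_
    · simp only [MonoidHom.comp_apply, GroupH.lift_x, map_mul, map_inv, map_pow,
        TorusKnotGroup.lift_zero, TorusKnotGroup.lift_one, MonoidHom.id_apply, inv_mul_cancel_left]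
    · simp only [MonoidHom.comp_apply, GroupH.lift_y, map_mul, map_inv, map_pow,
        TorusKnotGroup.lift_zero, TorusKnotGroup.lift_one, MonoidHom.id_apply]
      rw [pow_succ]
      group
  · refine PresentedGroup.ext fun i => ?_
    fin_cases i
    · simp only [Fin.zero_eta, MonoidHom.comp_apply, TorusKnotGroup.lift_zero, map_mul,
        GroupH.lift_x, GroupH.lift_y, MonoidHom.id_apply, inv_pow_mul_mul_inv_mul_pow_succ]
    · simp only [Fin.mk_one, MonoidHom.comp_apply, TorusKnotGroup.lift_one, map_mul, map_pow,
        GroupH.lift_x, GroupH.lift_y, MonoidHom.id_apply, inv_pow_mul_mul_inv_mul_pow_succ,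
        mul_inv_cancel_left]

/-! ### The trace ring of a two-generator group -/

/-- In a group generated by `x` and `y`, every `ρ g` is a combination of `1`, `ρ x`, `ρ y`,
`ρ (x y)` whose coefficients lie in any ring that contains `τ_x`, `τ_y`, `τ_{xy}`. -/
theorem exists_coeff_of_mem_closure_pair {G : Type*} [Group G] (x y : G)
    (R : Subring ((G →* Matrix.SpecialLinearGroup (Fin 2) ℂ) → ℂ))
    (hx : traceFun x ∈ R) (hy : traceFun y ∈ R) (hxy : traceFun (x * y) ∈ R)
    {g : G} (hg : g ∈ Subgroup.closure {x, y}) :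
    ∃ a ∈ R, ∃ b ∈ R, ∃ c ∈ R, ∃ d ∈ R, ∀ ρ : G →* Matrix.SpecialLinearGroup (Fin 2) ℂ,
      (ρ g).1 = a ρ • 1 + b ρ • (ρ x).1 + c ρ • (ρ y).1 + d ρ • ((ρ x).1 * (ρ y).1) := by
  have htx : ∀ ρ, (ρ x).1.trace = traceFun x ρ := fun ρ => rfl
  have hty : ∀ ρ, (ρ y).1.trace = traceFun y ρ := fun ρ => rfl
  have htxy : ∀ ρ, ((ρ x).1 * (ρ y).1).trace = traceFun (x * y) ρ := fun ρ => by
    rw [traceFun, map_mul, Matrix.SpecialLinearGroup.coe_mul]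
  -- These five identities are the nontrivial part of the table of left multiplication by `ρ x` and
  -- `ρ y` on `1`, `ρ x`, `ρ y`, `ρ x ρ y`. The coefficients are functions of `ρ` in `R`, the same
  -- formula for all `ρ`.
  have hxx : ∀ ρ, (ρ x).1 * (ρ x).1 = traceFun x ρ • (ρ x).1 - 1 := fun ρ =>
    SpecialLinearGroup.mul_self_eq _
  have hyy : ∀ ρ, (ρ y).1 * (ρ y).1 = traceFun y ρ • (ρ y).1 - 1 := fun ρ =>
    SpecialLinearGroup.mul_self_eq _
  have hyx : ∀ ρ, (ρ y).1 * (ρ x).1 = -((ρ x).1 * (ρ y).1) + traceFun x ρ • (ρ y).1 +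
      traceFun y ρ • (ρ x).1 + (traceFun (x * y) ρ - traceFun x ρ * traceFun y ρ) • 1 := fun ρ => by
    rw [mul_add_mul_comm_fin_two, htx, hty, htxy]
  have hxxy : ∀ ρ, (ρ x).1 * ((ρ x).1 * (ρ y).1) =
      traceFun x ρ • ((ρ x).1 * (ρ y).1) - (ρ y).1 := fun ρ => by
    rw [← mul_assoc, hxx, sub_mul, smul_mul_assoc, one_mul]
  have hyxy : ∀ ρ, (ρ y).1 * ((ρ x).1 * (ρ y).1) =
      traceFun (x * y) ρ • (ρ y).1 + (ρ x).1 - traceFun x ρ • 1 := fun ρ => by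
    rw [← mul_assoc, SpecialLinearGroup.mul_mul_self_eq, Matrix.trace_mul_comm, htxy, htx]
  have stepx : ∀ h : G, (∃ a ∈ R, ∃ b ∈ R, ∃ c ∈ R, ∃ d ∈ R,
      ∀ ρ : G →* Matrix.SpecialLinearGroup (Fin 2) ℂ,
      (ρ h).1 = a ρ • 1 + b ρ • (ρ x).1 + c ρ • (ρ y).1 + d ρ • ((ρ x).1 * (ρ y).1)) →
      ∃ a ∈ R, ∃ b ∈ R, ∃ c ∈ R, ∃ d ∈ R, ∀ ρ : G →* Matrix.SpecialLinearGroup (Fin 2) ℂ,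
      (ρ x).1 * (ρ h).1 =
        a ρ • 1 + b ρ • (ρ x).1 + c ρ • (ρ y).1 + d ρ • ((ρ x).1 * (ρ y).1) := by
    rintro h ⟨a, ha, b, hb, c, hc, d, hd, e⟩
    refine ⟨-b, neg_mem hb, a + traceFun x * b, add_mem ha (mul_mem hx hb), -d, neg_mem hd,
      c + traceFun x * d, add_mem hc (mul_mem hx hd), fun ρ => ?_⟩
    simp only [e, mul_add, mul_smul_comm, hxx, hxxy, mul_one, Pi.add_apply, Pi.mul_apply,
      Pi.neg_apply]
    module
  have stepy : ∀ h : G, (∃ a ∈ R, ∃ b ∈ R, ∃ c ∈ R, ∃ d ∈ R,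
      ∀ ρ : G →* Matrix.SpecialLinearGroup (Fin 2) ℂ,
      (ρ h).1 = a ρ • 1 + b ρ • (ρ x).1 + c ρ • (ρ y).1 + d ρ • ((ρ x).1 * (ρ y).1)) →
      ∃ a ∈ R, ∃ b ∈ R, ∃ c ∈ R, ∃ d ∈ R, ∀ ρ : G →* Matrix.SpecialLinearGroup (Fin 2) ℂ,
      (ρ y).1 * (ρ h).1 =
        a ρ • 1 + b ρ • (ρ x).1 + c ρ • (ρ y).1 + d ρ • ((ρ x).1 * (ρ y).1) := by
    rintro h ⟨a, ha, b, hb, c, hc, d, hd, e⟩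
    refine ⟨b * (traceFun (x * y) - traceFun x * traceFun y) - c - d * traceFun x,
      sub_mem (sub_mem (mul_mem hb (sub_mem hxy (mul_mem hx hy))) hc) (mul_mem hd hx),
      b * traceFun y + d, add_mem (mul_mem hb hy) hd,
      a + b * traceFun x + c * traceFun y + d * traceFun (x * y),
      add_mem (add_mem (add_mem ha (mul_mem hb hx)) (mul_mem hc hy)) (mul_mem hd hxy),
      -b, neg_mem hb, fun ρ => ?_⟩
    simp only [e, mul_add, mul_smul_comm, hyx, hyy, hyxy, mul_one, Pi.add_apply, Pi.mul_apply,
      Pi.neg_apply, Pi.sub_apply]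
    module
  -- Inverses reduce to the previous steps by `u⁻¹ = tr(u) - u`.
  have inv_step : ∀ (u h : G), traceFun u ∈ R →
      (∃ a ∈ R, ∃ b ∈ R, ∃ c ∈ R, ∃ d ∈ R, ∀ ρ : G →* Matrix.SpecialLinearGroup (Fin 2) ℂ,
      (ρ h).1 = a ρ • 1 + b ρ • (ρ x).1 + c ρ • (ρ y).1 + d ρ • ((ρ x).1 * (ρ y).1)) →
      (∃ a ∈ R, ∃ b ∈ R, ∃ c ∈ R, ∃ d ∈ R, ∀ ρ : G →* Matrix.SpecialLinearGroup (Fin 2) ℂ,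
      (ρ u).1 * (ρ h).1 =
        a ρ • 1 + b ρ • (ρ x).1 + c ρ • (ρ y).1 + d ρ • ((ρ x).1 * (ρ y).1)) →
      ∃ a ∈ R, ∃ b ∈ R, ∃ c ∈ R, ∃ d ∈ R, ∀ ρ : G →* Matrix.SpecialLinearGroup (Fin 2) ℂ,
      (ρ (u⁻¹ * h)).1 =
        a ρ • 1 + b ρ • (ρ x).1 + c ρ • (ρ y).1 + d ρ • ((ρ x).1 * (ρ y).1) := by
    rintro u h hu ⟨a, ha, b, hb, c, hc, d, hd, e⟩ ⟨a', ha', b', hb', c', hc', d', hd', e'⟩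
    refine ⟨traceFun u * a - a', sub_mem (mul_mem hu ha) ha',
      traceFun u * b - b', sub_mem (mul_mem hu hb) hb',
      traceFun u * c - c', sub_mem (mul_mem hu hc) hc',
      traceFun u * d - d', sub_mem (mul_mem hu hd) hd', fun ρ => ?_⟩
    have hu' : (ρ u).1.trace = traceFun u ρ := rfl
    rw [map_mul, map_inv, Matrix.SpecialLinearGroup.coe_mul, SpecialLinearGroup.inv_eq, hu',
      sub_mul, e', e]
    simp only [smul_mul_assoc, one_mul, Pi.sub_apply, Pi.mul_apply]
    module
  induction hg using Subgroup.closure_induction_left with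
  | one => exact ⟨1, one_mem _, 0, zero_mem _, 0, zero_mem _, 0, zero_mem _, fun ρ => by simp⟩
  | mul_left u hu h _ ih =>
    simp only [map_mul, Matrix.SpecialLinearGroup.coe_mul]
    rcases hu with rfl | rfl
    · exact stepx h ih
    · exact stepy h ih
  | inv_mul_cancel u hu h _ ih =>
    rcases hu with rfl | rfl
    · exact inv_step _ h hx ih (stepx h ih)
    · exact inv_step _ h hy ih (stepy h ih)

/-- The trace ring of a group generated by `x` and `y` is generated by `τ_x`, `τ_y`, `τ_{xy}`. -/
theorem generatesTraceRing_pair {G : Type*} [Group G] {x y : G}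
    (h : Subgroup.closure {x, y} = ⊤) : GeneratesTraceRing ![x, y, x * y] := by
  refine le_antisymm (Subring.closure_mono ?_) (Subring.closure_le.2 ?_)
  · rintro _ ⟨i, rfl⟩
    exact ⟨_, rfl⟩
  · rintro _ ⟨g, rfl⟩
    set R := Subring.closure (Set.range fun i => traceFun (![x, y, x * y] i)) with hR
    have hx : traceFun x ∈ R := Subring.subset_closure ⟨0, rfl⟩
    have hy : traceFun y ∈ R := Subring.subset_closure ⟨1, rfl⟩
    have hxy : traceFun (x * y) ∈ R := Subring.subset_closure ⟨2, rfl⟩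
    obtain ⟨a, ha, b, hb, c, hc, d, hd, e⟩ :=
      exists_coeff_of_mem_closure_pair x y R hx hy hxy (g := g) (by rw [h]; trivial)
    -- Take the trace of the expansion; the `2` is the trace of the identity matrix.
    have : traceFun g = a * 2 + b * traceFun x + c * traceFun y + d * traceFun (x * y) := by
      funext ρ
      simp only [traceFun, e, Matrix.trace_add, Matrix.trace_smul, Matrix.trace_one,
        Fintype.card_fin, Pi.add_apply, Pi.mul_apply, map_mul, Matrix.SpecialLinearGroup.coe_mul,
        smul_eq_mul]
      norm_num
    rw [this]
    have h2 : (2 : (G →* Matrix.SpecialLinearGroup (Fin 2) ℂ) → ℂ) ∈ R := ofNat_mem R 2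
    exact add_mem (add_mem (add_mem (mul_mem ha h2) (mul_mem hb hx)) (mul_mem hc hy))
      (mul_mem hd hxy)

/-! ### The character variety in the coordinates `τ_x`, `τ_y`, `τ_{xy}` -/

theorem GroupH.closure_x_y (m : ℕ) : Subgroup.closure {GroupH.x m, GroupH.y m} = ⊤ := by
  rw [← PresentedGroup.closure_range_of]
  congr 1
  ext g
  simp only [Set.mem_insert_iff, Set.mem_singleton_iff, Set.mem_range, Fin.exists_fin_two]
  exact or_congr eq_comm eq_comm

theorem GroupH.characterVariety_eq {m : ℕ} (hm : 1 < m) (hodd : Odd m) :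
    characterVariety ![GroupH.x m, GroupH.y m, GroupH.x m * GroupH.y m] =
      {v | v 1 = v 0 ∧ ![v 0, v 2] ∈ curveH m} := by
  have hm3 : 3 ≤ m := by
    obtain ⟨k, rfl⟩ := hodd
    omega
  ext v
  simp only [characterVariety, Set.mem_range, Set.mem_ofPred_eq, curveH, Matrix.cons_val_zero,
    Matrix.cons_val_one]
  constructor
  · rintro ⟨ρ, rfl⟩
    simp only [traceFun, Matrix.cons_val, map_mul, Matrix.SpecialLinearGroup.coe_mul]
    set A := ρ (GroupH.x m)
    set B := ρ (GroupH.y m)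
    have h : altWord A B m = altWord B A m := by
      rw [← map_altWord, GroupH.altWord_eq, map_altWord]
    have htr : A.1.trace = B.1.trace := by
      obtain ⟨k, rfl⟩ := hodd
      have h' := h
      rw [altWord_odd, altWord_odd, mul_pow_mul B A] at h'
      -- The relation `(AB)^k A = B (AB)^k` exhibits `B` as a conjugate of `A`.
      have hB : B = (A * B) ^ k * (A * ((A * B) ^ k)⁻¹) := by rw [← mul_assoc, h']; group
      conv_rhs => rw [hB, Matrix.SpecialLinearGroup.coe_mul, Matrix.trace_mul_comm,
        ← Matrix.SpecialLinearGroup.coe_mul, inv_mul_cancel_right]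
    refine ⟨htr.symm, mul_eq_zero.2 ?_⟩
    refine ((altWord_eq_iff hm3 hodd A B htr).1 h).imp_left fun hAB => ?_
    rw [← hAB, SpecialLinearGroup.mul_self_eq]
    simp
    ring
  · rintro ⟨h10, hv⟩
    suffices H : ∃ A B : Matrix.SpecialLinearGroup (Fin 2) ℂ, A.1.trace = v 0 ∧ B.1.trace = v 0 ∧
        (A.1 * B.1).trace = v 2 ∧ altWord A B m = altWord B A m by
      obtain ⟨A, B, hA, hB, hAB, h⟩ := H
      refine ⟨GroupH.lift A B h, ?_⟩
      funext i
      fin_cases i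
      · simpa [traceFun] using hA
      · simpa [traceFun, h10] using hB
      · simpa [traceFun] using hAB
    let A : Matrix.SpecialLinearGroup (Fin 2) ℂ := ⟨!![v 0, -1; 1, 0], by simp⟩
    have hA : A.1.trace = v 0 := by simp [A, Matrix.trace_fin_two]
    -- On the component `Z = X² - 2`, sending both generators to the same matrix is enough.
    rcases mul_eq_zero.1 hv with h | h
    · refine ⟨A, A, hA, hA, ?_, rfl⟩
      rw [SpecialLinearGroup.mul_self_eq, hA]
      simp [hA]
      linear_combination h
    · obtain ⟨t, ht, hz⟩ := exists_add_inv_eq (v 2)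
      -- Chosen so that `A * B` is upper triangular with diagonal `1/t`, `t`; its trace is then `v
      -- 2`, whatever `v 0` is.
      let B : Matrix.SpecialLinearGroup (Fin 2) ℂ :=
        ⟨!![0, t; -1 / t, v 0], by rw [Matrix.det_fin_two_of]; field_simp; ring⟩
      have hB : B.1.trace = v 0 := by simp [B, Matrix.trace_fin_two]
      have hAB : (A.1 * B.1).trace = v 2 := by
        simp only [A, B, Matrix.mul_fin_two, Matrix.trace_fin_two_of]
        rw [← hz]
        ring
      refine ⟨A, B, hA, hB, hAB, (altWord_eq_iff hm3 hodd A B (hA.trans hB.symm)).2 (Or.inr ?_)⟩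
      rw [hAB]
      exact h

/-! ### Independence of the generating family -/

/-- Turns membership in a generated ring of functions into a polynomial expression valid at all
points at once; these polynomials are the components of the isomorphisms. -/
theorem exists_mvPolynomial_of_mem_closure {α ι : Type*} {f : ι → α → ℂ} {g : α → ℂ}
    (hg : g ∈ Subring.closure (Set.range f)) :
    ∃ P : MvPolynomial ι ℂ, ∀ a, MvPolynomial.eval (fun i => f i a) P = g a := by
  induction hg using Subring.closure_induction with
  | mem _ h =>
    obtain ⟨i, rfl⟩ := h
    exact ⟨MvPolynomial.X i, fun a => by simp⟩
  | zero => exact ⟨0, fun a => by simp⟩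
  | one => exact ⟨1, fun a => by simp⟩
  | add _ _ _ _ h1 h2 =>
    obtain ⟨P, hP⟩ := h1
    obtain ⟨Q, hQ⟩ := h2
    exact ⟨P + Q, fun a => by simp [hP, hQ]⟩
  | neg _ _ h =>
    obtain ⟨P, hP⟩ := h
    exact ⟨-P, fun a => by simp [hP]⟩
  | mul _ _ _ _ h1 h2 =>
    obtain ⟨P, hP⟩ := h1
    obtain ⟨Q, hQ⟩ := h2
    exact ⟨P * Q, fun a => by simp [hP, hQ]⟩

/-- Up to isomorphism, the character variety does not depend on the generating family. -/
theorem GeneratesTraceRing.algSetIso {G ι κ : Type*} [Group G] {γ : ι → G} {δ : κ → G}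
    (hγ : GeneratesTraceRing γ) (hδ : GeneratesTraceRing δ) :
    AlgSetIso (characterVariety γ) (characterVariety δ) := by
  have mem : ∀ g : G, traceFun g ∈ traceRing G := fun g => Subring.subset_closure ⟨g, rfl⟩
  have h1 : ∀ k, ∃ P : MvPolynomial ι ℂ, ∀ ρ,
      MvPolynomial.eval (fun i => traceFun (γ i) ρ) P = traceFun (δ k) ρ := fun k =>
    exists_mvPolynomial_of_mem_closure (by rw [hγ]; exact mem _)
  have h2 : ∀ i, ∃ P : MvPolynomial κ ℂ, ∀ ρ,
      MvPolynomial.eval (fun k => traceFun (δ k) ρ) P = traceFun (γ i) ρ := fun k =>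
    exists_mvPolynomial_of_mem_closure (by rw [hδ]; exact mem _)
  choose F hF using h1
  choose E hE using h2
  have hF' : ∀ ρ, polyMap F (fun i => traceFun (γ i) ρ) = fun k => traceFun (δ k) ρ := fun ρ =>
    funext fun k => hF k ρ
  have hE' : ∀ ρ, polyMap E (fun k => traceFun (δ k) ρ) = fun i => traceFun (γ i) ρ := fun ρ =>
    funext fun i => hE i ρ
  refine ⟨F, E, ?_, ?_, ?_, ?_⟩
  · rintro _ ⟨ρ, rfl⟩
    exact ⟨ρ, (hF' ρ).symm⟩
  · rintro _ ⟨ρ, rfl⟩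
    exact ⟨ρ, (hE' ρ).symm⟩
  · rintro _ ⟨ρ, rfl⟩
    simp only [hF', hE']
  · rintro _ ⟨ρ, rfl⟩
    simp only [hF', hE']

theorem polyMap_polyMap {ι κ μ : Type*} (F : κ → MvPolynomial ι ℂ) (E : μ → MvPolynomial κ ℂ)
    (v : ι → ℂ) : polyMap (fun l => MvPolynomial.bind₁ F (E l)) v = polyMap E (polyMap F v) := by
  funext l
  simp only [polyMap, MvPolynomial.eval, MvPolynomial.eval₂Hom_bind₁]
  rfl

theorem AlgSetIso.trans {ι κ μ : Type*} {U : Set (ι → ℂ)} {V : Set (κ → ℂ)} {W : Set (μ → ℂ)}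
    (h₁ : AlgSetIso U V) (h₂ : AlgSetIso V W) : AlgSetIso U W := by
  obtain ⟨F, E, a, b, c, d⟩ := h₁
  obtain ⟨F', E', a', b', c', d'⟩ := h₂
  refine ⟨fun l => MvPolynomial.bind₁ F (F' l), fun i => MvPolynomial.bind₁ E' (E i), ?_, ?_, ?_, ?_⟩
  · intro v hv
    rw [polyMap_polyMap]
    exact a' _ (a v hv)
  · intro w hw
    rw [polyMap_polyMap]
    exact b _ (b' w hw)
  · intro v hv
    rw [polyMap_polyMap, polyMap_polyMap, c' _ (a v hv), c v hv]
  · intro w hw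
    rw [polyMap_polyMap, polyMap_polyMap, d _ (b' w hw), d' w hw]

/-- A plane set is isomorphic to its image in the plane `Y = X` of three-space. -/
theorem algSetIso_diagonal (W : Set (Fin 2 → ℂ)) :
    AlgSetIso {v : Fin 3 → ℂ | v 1 = v 0 ∧ ![v 0, v 2] ∈ W} W := by
  have hF : ∀ v : Fin 3 → ℂ,
      polyMap ![MvPolynomial.X 0, MvPolynomial.X 2] v = ![v 0, v 2] := fun v => by
    funext i; fin_cases i <;> simp [polyMap]
  have hE : ∀ w : Fin 2 → ℂ,
      polyMap ![MvPolynomial.X 0, MvPolynomial.X 0, MvPolynomial.X 1] w = ![w 0, w 0, w 1] :=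
    fun w => by funext i; fin_cases i <;> simp [polyMap]
  have hw : ∀ w : Fin 2 → ℂ, ![w 0, w 1] = w := fun w => by
    funext i; fin_cases i <;> rfl
  refine ⟨_, ![MvPolynomial.X 0, MvPolynomial.X 0, MvPolynomial.X 1],
    fun v hv => (hF v).symm ▸ hv.2, fun w h => ?_, fun v hv => ?_, fun w _ => ?_⟩
  · rw [hE]
    exact ⟨rfl, (hw w).symm ▸ h⟩
  · rw [hF, hE]
    funext i
    fin_cases i
    · rfl
    · exact hv.1.symm
    · rfl
  · rw [hE, hF]
    exact hw w

theorem mainTheorem1 (m : ℕ) (hm : 1 < m) (hodd : Odd m) :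
    -- `H_m` is isomorphic to the group of the torus knot of type `(m, 2)`
    Nonempty (GroupH m ≃* TorusKnotGroup m 2) ∧
    -- whatever finite generating family is used to define `X(H_m)`, it is isomorphic to the curve
    (∀ (ν : ℕ) (γ : Fin ν → GroupH m), GeneratesTraceRing γ →
      AlgSetIso (characterVariety γ) (curveH m)) ∧
    -- the family `x, y, xy` is such a family
    GeneratesTraceRing ![GroupH.x m, GroupH.y m, GroupH.x m * GroupH.y m] ∧
    -- in the coordinates it defines, `X(H_m)` lies in `Y = X` and projects onto the curve
    characterVariety ![GroupH.x m, GroupH.y m, GroupH.x m * GroupH.y m] =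
      {v | v 1 = v 0 ∧ ![v 0, v 2] ∈ curveH m} := by
  have hgen := generatesTraceRing_pair (GroupH.closure_x_y m)
  have heq := GroupH.characterVariety_eq hm hodd
  refine ⟨nonempty_groupH_mulEquiv_torusKnotGroup hodd, fun ν γ hγ => ?_, hgen, heq⟩
  have h := hγ.algSetIso hgen
  rw [heq] at h
  exact h.trans (algSetIso_diagonal _)
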